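/- Let $A,a,b,c>0$ be real numbers and let $$G_\theta(z)=A\,(1-z)^{-c}\exp\bigl(a(1-z)^{-b}\bigr),\qquad |z|<1$$ (principal powers). For $n\ge 1$ let $\theta_n=[z^{n-1}]\,G_\theta(z)$ be the coefficient of $z^{n-1}$ in the Taylor expansion of $G_\theta$ at $0$. Then, for $n\ge1$, $$\theta_{n+1}=\frac{A\,(ab)^{\frac1{b+1}\left(\frac12-c\right)}}{\sqrt{2\pi(b+1)}}\;n^{\frac1{b+1}\left(c-\frac{b+2}2\right)}\exp\Bigl\{a(b+1)(ab)^{-\frac b{b+1}}\,n^{\frac b{b+1}}+\tfrac12(ab)^{\frac2{b+1}}\,n^{\frac{b-1}{b+1}}+\varepsilon_n\Bigr\},$$ where $(\varepsilon_n)$ is a sequence of real numbers with $\varepsilon_n=o\bigl(n^{\max\left(\frac{b-1}{b+1},\,0\right)}\bigr)$ as $n\to\infty$. -/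

import Mathlib

open Filter Asymptotics

/-- The generating function `G(z) = A (1 - z)^(-c) exp (a (1 - z)^(-b))`, with principal powers;
it is holomorphic on the open unit disc. -/
noncomputable def subExpGenFun (A a b c : ℝ) (z : ℂ) : ℂ :=
  (A : ℂ) * (1 - z) ^ (-(c : ℂ)) * Complex.exp ((a : ℂ) * (1 - z) ^ (-(b : ℂ)))

/-- The `n`-th Taylor coefficient at the origin, `[z^n] G(z)`. -/
noncomputable def taylorCoeffZero (G : ℂ → ℂ) (n : ℕ) : ℂ :=
  iteratedDeriv n G 0 / (n.factorial : ℂ)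

/-- The parameters `θ_n = [z^(n-1)] G(z)`, for `n ≥ 1` (the value at `n = 0` is not used). -/
noncomputable def subExpTheta (A a b c : ℝ) (n : ℕ) : ℂ :=
  taylorCoeffZero (subExpGenFun A a b c) (n - 1)

/-!
The coefficient of `z ^ n` in `G` is computed by the saddle point method. Write `u = 1 - |z|`. On
the positive axis the integrand `G(z) / z ^ n` of Cauchy's formula is
`A u ^ (-c) exp (a u ^ (-b) - n log (1 - u))`, and the circle is taken through the minimizer `u` of
the exponent, `n u ^ (b + 1) = a b (1 - u)`.

With the angle rescaled to `u v x`, `v = u ^ (b / 2)`, and the value at angle `0` divided out, the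
integrand converges pointwise to `exp (-a b (b + 1) x ^ 2 / 2)` (`tendsto_scaledIntegrand`). Since
`|1 - z| ^ 2 ≥ u ^ 2 (1 + (2 / π ^ 2) (v x) ^ 2)` on the whole circle once `u ≤ 1 / 2`, it is dominated by a Gaussian
plus a stretched exponential of exponent `2 b / (b + 2)`, so dominated convergence applies without a
separate treatment of the arc away from the saddle (`tendsto_integral_scaledIntegrand`). This gives
`[z ^ n] G` up to a factor `1 + o(1)`, in terms of `u`.

It remains to pass from `u` to its first approximation `u₀ = (a b / n) ^ (1 / (b + 1))`, which
minimizes `a u ^ (-b) + n u`. Their ratio tends to `1` (`saddlePoint_bounds`), and comparing the two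
minimization problems shows that the exponent at `u` is
`a u₀ ^ (-b) + n u₀ + n u₀ ^ 2 / 2 + O(n u₀ ^ 3)` (`abs_saddleValue_sub_le`). The first three terms
are the two main terms of the statement, and `n u₀ ^ 3` has order `n ^ ((b - 2) / (b + 1))`, which
the allowed error absorbs for every `b > 0`.

The coefficients are positive reals because `G' = G H` with `H` of positive coefficients
(`iteratedDeriv_subExpGenFun_pos`); hence the formula with a real `ε` holds for every `n ≥ 1`, and
only the growth of `ε` is an asymptotic statement.
-/

/-! ### Positivity of the Taylor coefficients -/

section Positivity

open scoped ComplexOrder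

lemma one_sub_mem_slitPlane {z : ℂ} (hz : ‖z‖ < 1) : 1 - z ∈ Complex.slitPlane := by
  left
  have := (Complex.re_le_norm z).trans_lt hz
  simpa using this

lemma hasDerivAt_one_sub_cpow (s : ℝ) {z : ℂ} (hz : ‖z‖ < 1) :
    HasDerivAt (fun z : ℂ => (1 - z) ^ (-(s : ℂ)))
      ((s : ℂ) * (1 - z) ^ (-((s + 1 : ℝ) : ℂ))) z := by
  have h := ((hasDerivAt_id z).const_sub 1).cpow_const (c := -(s : ℂ)) (one_sub_mem_slitPlane hz)
  refine h.congr_deriv ?_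
  have : -((s + 1 : ℝ) : ℂ) = -(s : ℂ) - 1 := by push_cast; ring
  rw [this]
  simp

lemma differentiableOn_one_sub_cpow (s : ℝ) :
    DifferentiableOn ℂ (fun z : ℂ => (1 - z) ^ (-(s : ℂ))) (Metric.ball 0 1) := fun _ hz =>
  (hasDerivAt_one_sub_cpow s (by simpa using hz)).differentiableAt.differentiableWithinAt

lemma contDiffAt_zero_of_differentiableOn_ball {f : ℂ → ℂ}
    (hf : DifferentiableOn ℂ f (Metric.ball 0 1)) (n : ℕ) : ContDiffAt ℂ n f 0 :=
  (hf.analyticAt (Metric.ball_mem_nhds 0 one_pos)).contDiffAt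

lemma iteratedDeriv_one_sub_cpow_pos (n : ℕ) :
    ∀ {s : ℝ}, 0 < s → 0 < iteratedDeriv n (fun z : ℂ => (1 - z) ^ (-(s : ℂ))) 0 := by
  induction n with
  | zero => intro s hs; simp
  | succ n ih =>
    intro s hs
    have h : deriv (fun z : ℂ => (1 - z) ^ (-(s : ℂ))) =ᶠ[nhds 0]
        fun z => (s : ℂ) * (1 - z) ^ (-((s + 1 : ℝ) : ℂ)) := by
      filter_upwards [Metric.ball_mem_nhds (0 : ℂ) one_pos] with z hz
      exact (hasDerivAt_one_sub_cpow s (by simpa using hz)).deriv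
    rw [iteratedDeriv_succ', h.iteratedDeriv_eq, iteratedDeriv_const_mul_field]
    exact mul_pos (by exact_mod_cast hs) (ih (by linarith))

lemma differentiableOn_subExpGenFun (A a b c : ℝ) :
    DifferentiableOn ℂ (subExpGenFun A a b c) (Metric.ball 0 1) :=
  ((differentiableOn_one_sub_cpow c).const_mul _).mul
    ((differentiableOn_one_sub_cpow b).const_mul _).cexp

/-- The generating function solves `G' = G H` with
`H = c (1 - z)⁻¹ + a b (1 - z)^(-(b + 1))`. -/
lemma hasDerivAt_subExpGenFun (A a b c : ℝ) {z : ℂ} (hz : ‖z‖ < 1) :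
    HasDerivAt (subExpGenFun A a b c)
      (subExpGenFun A a b c z * ((c : ℂ) * (1 - z) ^ (-((1 : ℝ) : ℂ))
        + ((a * b : ℝ) : ℂ) * (1 - z) ^ (-((b + 1 : ℝ) : ℂ)))) z := by
  have h := ((hasDerivAt_one_sub_cpow c hz).const_mul (A : ℂ)).mul
    ((hasDerivAt_one_sub_cpow b hz).const_mul (a : ℂ)).cexp
  refine h.congr_deriv ?_
  have h0 : (1 - z) ≠ 0 := Complex.slitPlane_ne_zero (one_sub_mem_slitPlane hz)
  have h1 : (1 - z) ^ (-((c + 1 : ℝ) : ℂ)) = (1 - z) ^ (-(c : ℂ)) * (1 - z) ^ (-((1 : ℝ) : ℂ)) := by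
    rw [← Complex.cpow_add _ _ h0]; congr 1; push_cast; ring
  rw [h1]
  simp only [subExpGenFun]
  push_cast
  ring

/-- All Taylor coefficients are positive reals: by Leibniz' rule, the differential equation
`G' = G H` with `H` of positive coefficients expresses each derivative of `G` at the origin
through the lower ones with positive weights. -/
lemma iteratedDeriv_subExpGenFun_pos {A a b c : ℝ} (hA : 0 < A) (ha : 0 < a) (hb : 0 < b)
    (hc : 0 < c) (n : ℕ) : 0 < iteratedDeriv n (subExpGenFun A a b c) 0 := by
  set H : ℂ → ℂ := fun z => (c : ℂ) * (1 - z) ^ (-((1 : ℝ) : ℂ))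
        + ((a * b : ℝ) : ℂ) * (1 - z) ^ (-((b + 1 : ℝ) : ℂ)) with hHdef
  have hHd : DifferentiableOn ℂ H (Metric.ball 0 1) :=
    ((differentiableOn_one_sub_cpow 1).const_mul _).add
      ((differentiableOn_one_sub_cpow (b + 1)).const_mul _)
  have hH : ∀ k, 0 < iteratedDeriv k H 0 := by
    intro k
    have h1 := contDiffAt_zero_of_differentiableOn_ball
      ((differentiableOn_one_sub_cpow 1).const_mul (c : ℂ)) k
    have h2 := contDiffAt_zero_of_differentiableOn_ball
      ((differentiableOn_one_sub_cpow (b + 1)).const_mul ((a * b : ℝ) : ℂ)) k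
    rw [hHdef, iteratedDeriv_fun_add h1 h2, iteratedDeriv_const_mul_field,
      iteratedDeriv_const_mul_field]
    exact add_pos (mul_pos (by exact_mod_cast hc) (iteratedDeriv_one_sub_cpow_pos k one_pos))
      (mul_pos (by exact_mod_cast mul_pos ha hb) (iteratedDeriv_one_sub_cpow_pos k (by linarith)))
  induction n using Nat.strong_induction_on with
  | _ n ih =>
    rcases n with _ | n
    · have : subExpGenFun A a b c 0 = ((A * Real.exp a : ℝ) : ℂ) := by simp [subExpGenFun]
      rw [iteratedDeriv_zero, this]
      exact_mod_cast mul_pos hA (Real.exp_pos a)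
    · have h : deriv (subExpGenFun A a b c) =ᶠ[nhds 0] subExpGenFun A a b c * H := by
        filter_upwards [Metric.ball_mem_nhds (0 : ℂ) one_pos] with z hz
        exact (hasDerivAt_subExpGenFun A a b c (by simpa using hz)).deriv
      rw [iteratedDeriv_succ', h.iteratedDeriv_eq, iteratedDeriv_mul
        (contDiffAt_zero_of_differentiableOn_ball (differentiableOn_subExpGenFun A a b c) n)
        (contDiffAt_zero_of_differentiableOn_ball hHd n)]
      refine Finset.sum_pos (fun i hi => ?_) ⟨0, by simp⟩
      rw [Finset.mem_range] at hi
      have hch : (0 : ℂ) < (n.choose i : ℂ) := by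
        exact_mod_cast Nat.choose_pos (by omega)
      exact mul_pos (mul_pos hch (ih i hi)) (hH _)

lemma exists_subExpTheta_eq_ofReal {A a b c : ℝ} (hA : 0 < A) (ha : 0 < a) (hb : 0 < b)
    (hc : 0 < c) (n : ℕ) : ∃ t : ℝ, 0 < t ∧ subExpTheta A a b c (n + 1) = (t : ℂ) := by
  have h : 0 < subExpTheta A a b c (n + 1) :=
    mul_pos (iteratedDeriv_subExpGenFun_pos hA ha hb hc n)
      (by
        have h : (0 : ℝ) < (n.factorial : ℝ)⁻¹ := by positivity
        simpa using Complex.zero_lt_real.2 h)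
  obtain ⟨h1, h2⟩ := Complex.lt_def.1 h
  exact ⟨_, h1, Complex.ext (by simp) (by simpa using h2.symm)⟩

end Positivity

/-! ### The coefficients as integrals over circles -/

section Cauchy

open Complex Real

/-- Cauchy's formula on the circle of radius `r`, with the angle in `[-π, π]`. -/
lemma taylorCoeffZero_eq_integral {G : ℂ → ℂ} (hG : DifferentiableOn ℂ G (Metric.ball 0 1))
    {r : ℝ} (hr0 : 0 < r) (hr1 : r < 1) (n : ℕ) :
    taylorCoeffZero G n = (2 * π : ℂ)⁻¹ *
      ∫ φ in (-π)..π, G (r * exp (φ * I)) / (r * exp (φ * I)) ^ n := by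
  have h := DifferentiableOn.circleIntegral_one_div_sub_center_pow_smul hr0 n
    (hG.mono (Metric.closedBall_subset_ball hr1))
  have hper : Function.Periodic
      (fun φ : ℝ => G (r * exp (φ * I)) / (r * exp (φ * I)) ^ n) (2 * π) := by
    intro φ
    have : exp (((φ + 2 * π : ℝ) : ℂ) * I) = exp (φ * I) := by
      push_cast; rw [add_mul, Complex.exp_add, Complex.exp_two_pi_mul_I, mul_one]
    simp only [this]
  have hshift := hper.intervalIntegral_add_eq (-π) 0
  rw [show -π + 2 * π = π by ring, zero_add] at hshift
  have hne : ∀ φ : ℝ, (r * exp (φ * I) : ℂ) ≠ 0 := fun φ =>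
    mul_ne_zero (by exact_mod_cast hr0.ne') (Complex.exp_ne_zero _)
  have hcirc : ∮ z in C(0, r), (1 / (z - 0) ^ (n + 1)) • G z
      = I * ∫ φ in (0 : ℝ)..(2 * π), G (r * exp (φ * I)) / (r * exp (φ * I)) ^ n := by
    rw [circleIntegral, ← intervalIntegral.integral_const_mul]
    refine intervalIntegral.integral_congr fun φ _ => ?_
    have := hne φ
    simp only [deriv_circleMap, circleMap, zero_add, sub_zero, smul_eq_mul]
    field_simp
    ring
  rw [hcirc, smul_eq_mul] at h
  rw [hshift, taylorCoeffZero]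
  have hpi : (π : ℂ) ≠ 0 := by exact_mod_cast Real.pi_ne_zero
  have hn : (n.factorial : ℂ) ≠ 0 := by exact_mod_cast n.factorial_ne_zero
  have h' : ∫ φ in (0 : ℝ)..(2 * π), G (r * exp (φ * I)) / (r * exp (φ * I)) ^ n
      = 2 * π / n.factorial * iteratedDeriv n G 0 := by
    apply mul_left_cancel₀ Complex.I_ne_zero
    rw [h]; ring
  rw [h']
  field_simp

end Cauchy

/-! ### The normalized integrand -/

section Saddle

open Complex Real MeasureTheory Topology

/-- The quotient `(1 - z) / u` on the circle `|z| = 1 - u`, at the point `z` of angle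
`u v x`. -/
noncomputable def scaledDist (u v x : ℝ) : ℂ :=
  (1 - (1 - u) * exp ((u * v * x : ℝ) * I)) / u

/-- The integrand of Cauchy's formula for the `n`-th coefficient on the circle `|z| = 1 - u`, at
angle `u v x` and divided by its value at angle `0`.  It is used with `v = u ^ (b / 2)`, so
that `a / v ^ 2 = a u ^ (-b)`. -/
noncomputable def scaledIntegrand (a b c : ℝ) (n : ℕ) (u v x : ℝ) : ℂ :=
  scaledDist u v x ^ (-(c : ℂ)) *
    exp ((a / v ^ 2 : ℝ) * (scaledDist u v x ^ (-(b : ℂ)) - 1) - n * (u * v * x : ℝ) * I)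

lemma norm_sq_scaledDist_ge {u v x : ℝ} (hu0 : 0 < u) (hu1 : u ≤ 1 / 2)
    (hx : |u * v * x| ≤ π) : 1 + 2 / π ^ 2 * (v * x) ^ 2 ≤ ‖scaledDist u v x‖ ^ 2 := by
  set φ := u * v * x with hφ
  have hcos := Real.cos_le_one_sub_mul_cos_sq hx
  have hn : ‖scaledDist u v x‖ ^ 2 = 1 + 2 * (1 - u) * (1 - Real.cos φ) / u ^ 2 := by
    rw [scaledDist, norm_div, div_pow, ← hφ, ← Complex.normSq_eq_norm_sq, Complex.exp_mul_I,
      ← Complex.ofReal_cos, ← Complex.ofReal_sin, Complex.normSq_apply, Complex.norm_real,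
      Real.norm_eq_abs, sq_abs]
    simp only [sub_re, sub_im, mul_re, mul_im, add_re, add_im, one_re, one_im, ofReal_re,
      ofReal_im, I_re, I_im]
    field_simp
    linear_combination (1 - u) ^ 2 * Real.sin_sq_add_cos_sq φ
  rw [hn]
  have h1 : 2 / π ^ 2 * φ ^ 2 ≤ 2 * (1 - u) * (1 - Real.cos φ) := by
    have h0 : 0 ≤ 2 / π ^ 2 * φ ^ 2 := by positivity
    nlinarith
  have h2 : 2 / π ^ 2 * (v * x) ^ 2 = 2 / π ^ 2 * φ ^ 2 / u ^ 2 := by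
    rw [hφ]; field_simp
  rw [h2]
  gcongr

/-- As `t` grows from `0`, the power `(1 + κ t) ^ (-b / 2)` falls below `1` at least linearly until
`t = 1`, and stays away from `1` afterwards. -/
lemma exists_one_sub_rpow_ge {b κ : ℝ} (hb : 0 < b) (hκ : 0 < κ) : ∃ δ > 0, ∀ t R : ℝ, 0 ≤ t →
    0 ≤ R → 1 + κ * t ≤ R ^ 2 → δ * min t 1 ≤ 1 - R ^ (-b) := by
  set Y := b / 2 * (κ / (1 + κ)) with hY
  have hY0 : 0 < Y := by positivity
  refine ⟨Y / (1 + Y), by positivity, fun t R ht hR h => ?_⟩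
  have hR1 : 1 ≤ R ^ 2 := by nlinarith [mul_nonneg hκ.le ht]
  have hR0 : 0 < R := by
    rcases hR.eq_or_lt with h0 | h0
    · rw [← h0] at hR1; norm_num at hR1
    · exact h0
  set m := min t 1 with hm
  have hm0 : 0 ≤ m := le_min ht zero_le_one
  have hm1 : m ≤ 1 := min_le_right _ _
  have hmt : m ≤ t := min_le_left _ _
  have hlog : κ / (1 + κ) * m ≤ 2 * Real.log R := by
    have h1 : 1 - (1 + κ * m)⁻¹ ≤ Real.log (1 + κ * m) :=
      Real.one_sub_inv_le_log_of_pos (by positivity)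
    have h2 : Real.log (1 + κ * m) ≤ Real.log (R ^ 2) :=
      Real.log_le_log (by positivity) (by nlinarith)
    rw [Real.log_pow] at h2
    have h3 : κ / (1 + κ) * m ≤ 1 - (1 + κ * m)⁻¹ := by
      have : 1 - (1 + κ * m)⁻¹ = κ * m / (1 + κ * m) := by
        field_simp; ring
      rw [this, div_mul_eq_mul_div]
      gcongr
      nlinarith
    push_cast at h2
    linarith
  have hRb : R ^ (-b) ≤ (1 + Y * m)⁻¹ := by
    rw [Real.rpow_neg hR, Real.rpow_def_of_pos hR0]
    have h1 : Y * m ≤ Real.log R * b := by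
      have := mul_le_mul_of_nonneg_left hlog (half_pos hb).le
      rw [hY]; linarith
    exact inv_anti₀ (by positivity)
      (by linarith [Real.add_one_le_exp (Y * m), Real.exp_le_exp.2 h1])
  have : Y / (1 + Y) * m ≤ 1 - (1 + Y * m)⁻¹ := by
    have : 1 - (1 + Y * m)⁻¹ = Y * m / (1 + Y * m) := by
      field_simp; ring
    rw [this, div_mul_eq_mul_div]
    gcongr
    nlinarith
  linarith

/-- The integrand decays like a Gaussian for `|v x| ≤ 1`; beyond that it is at most
`exp (-a δ / v ^ 2)`.  Only `Re w ^ (-b) ≤ |w| ^ (-b)` is used, so the bound holds on the whole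
circle. -/
lemma norm_scaledIntegrand_le {a b c δ : ℝ} (ha : 0 < a) (hc : 0 < c) (n : ℕ) {u v x : ℝ}
    (hu0 : 0 < u) (hu1 : u ≤ 1 / 2) (hv : v ≠ 0) (hx : |u * v * x| ≤ π)
    (hδ : ∀ t R : ℝ, 0 ≤ t → 0 ≤ R → 1 + 2 / π ^ 2 * t ≤ R ^ 2 → δ * min t 1 ≤ 1 - R ^ (-b)) :
    ‖scaledIntegrand a b c n u v x‖ ≤ Real.exp (-(a * δ * min (x ^ 2) (v ^ 2)⁻¹)) := by
  have hq := norm_sq_scaledDist_ge hu0 hu1 hx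
  have hq1 : 1 ≤ ‖scaledDist u v x‖ := by
    have : 0 ≤ 2 / π ^ 2 * (v * x) ^ 2 := by positivity
    nlinarith [norm_nonneg (scaledDist u v x)]
  have hd := hδ _ _ (sq_nonneg (v * x)) (norm_nonneg _) hq
  have hre : (scaledDist u v x ^ (-(b : ℂ))).re ≤ ‖scaledDist u v x‖ ^ (-b) := by
    refine (Complex.re_le_norm _).trans_eq ?_
    rw [← Complex.ofReal_neg, Complex.norm_cpow_real]
  have hc1 : ‖scaledDist u v x ^ (-(c : ℂ))‖ ≤ 1 := by
    rw [← Complex.ofReal_neg, Complex.norm_cpow_real]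
    exact Real.rpow_le_one_of_one_le_of_nonpos hq1 (by linarith)
  rw [scaledIntegrand, norm_mul, Complex.norm_exp]
  refine (mul_le_of_le_one_left (Real.exp_pos _).le hc1).trans (Real.exp_le_exp.2 ?_)
  have hre2 : ((a / v ^ 2 : ℝ) * (scaledDist u v x ^ (-(b : ℂ)) - 1)
      - n * (u * v * x : ℝ) * I : ℂ).re
      = a / v ^ 2 * ((scaledDist u v x ^ (-(b : ℂ))).re - 1) := by
    rw [sub_re, re_ofReal_mul]
    have : ((n : ℂ) * (u * v * x : ℝ) * I).re = 0 := by
      rw [← Complex.ofReal_natCast, ← Complex.ofReal_mul, Complex.re_ofReal_mul]; simp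
    rw [this]; simp
  rw [hre2]
  have hmin : min (x ^ 2) (v ^ 2)⁻¹ = (v ^ 2)⁻¹ * min ((v * x) ^ 2) 1 := by
    rw [mul_min_of_nonneg _ _ (by positivity)]
    congr 1
    · field_simp
    · rw [mul_one]
  rw [hmin]
  have hav : 0 < a / v ^ 2 := by positivity
  have := mul_le_mul_of_nonneg_left (hd.trans (sub_le_sub_left hre 1)) hav.le
  calc _ = -(a / v ^ 2 * (1 - (scaledDist u v x ^ (-(b : ℂ))).re)) := by ring
    _ ≤ -(a / v ^ 2 * (δ * min ((v * x) ^ 2) 1)) := neg_le_neg this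
    _ = _ := by ring

lemma integrable_exp_neg_mul_abs_rpow {m p : ℝ} (hm : 0 < m) (hp : 0 < p) :
    Integrable fun x : ℝ => Real.exp (-m * |x| ^ p) := by
  have h : IntegrableOn (fun x : ℝ => Real.exp (-m * |x| ^ p)) (Set.Ioi 0) := by
    refine (integrableOn_rpow_mul_exp_neg_mul_rpow (s := 0) (by norm_num) hp hm).congr_fun
      (fun x hx => ?_) measurableSet_Ioi
    simp [abs_of_pos (Set.mem_Ioi.1 hx)]
  have h' : IntegrableOn (fun x : ℝ => Real.exp (-m * |x| ^ p)) (Set.Iic 0) := by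
    have := ((integrableOn_Ici_iff_integrableOn_Ioi (by simp)).2 h).comp_neg
    simpa using this
  rw [← integrableOn_univ, ← Set.Iic_union_Ioi (a := (0 : ℝ))]
  exact h'.union h

end Saddle

/-! ### Laplace's method on the circle through the saddle point -/

section SaddleLimit

open Complex Real MeasureTheory Topology

/-- Taylor expansion of `(1 + h) ^ (-b)` at `0` to second order. -/
lemma one_add_cpow_sub_taylor_isBigO (b : ℝ) :
    (fun h : ℂ => (1 + h) ^ (-(b : ℂ)) - (1 - b * h + b * (b + 1) / 2 * h ^ 2)) =O[𝓝 0]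
      fun h => ‖h‖ ^ 3 := by
  refine (Complex.one_add_cpow_hasFPowerSeriesAt_zero
    (a := -(b : ℂ))).isBigO_sub_partialSum_pow 3 |>.congr_left fun h => ?_
  simp only [zero_add, FormalMultilinearSeries.partialSum, Finset.sum_range_succ,
    Finset.sum_range_zero, binomialSeries_apply, List.ofFn_const, List.prod_replicate,
    smul_eq_mul, Ring.choose_zero_right, Ring.choose_one_right]
  have h2 : Ring.choose (-(b : ℂ)) 2 = b * (b + 1) / 2 := by
    rw [Ring.choose_eq_smul]
    simp [descPochhammer_succ_right, Polynomial.smeval_mul, Polynomial.smeval_sub,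
      Polynomial.smeval_one, Polynomial.smeval_X]
    ring
  rw [h2]
  ring

/-- `scaledDist` deviates from its value `1` at angle `0` by `O(v x)`, and from the first-order
expansion `1 - (1 - u) v x I` by `O(u (v x) ^ 2)`. -/
lemma scaledDist_sub_one_bounds {u v x : ℝ} (hu0 : 0 < u) (hu1 : u < 1) (hv : 0 < v)
    (hx : |u * v * x| ≤ 1) :
    ‖scaledDist u v x - 1‖ ≤ 2 * (v * |x|) ∧
    ‖scaledDist u v x - 1 + (1 - u) * (v * x) * I‖ ≤ u * (v * x) ^ 2 := by
  set φ := u * v * x with hφ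
  have hu : (u : ℂ) ≠ 0 := by exact_mod_cast hu0.ne'
  have hn : ‖(φ * I : ℂ)‖ = |φ| := by simp
  have hI : ‖(φ * I : ℂ)‖ ≤ 1 := by rw [hn]; exact hx
  have h1 := Complex.norm_exp_sub_one_sub_id_le hI
  have h0 := Complex.norm_exp_sub_one_le hI
  rw [hn] at h0 h1
  have hu' : ‖(1 - u : ℂ)‖ ≤ 1 := by
    rw [← Complex.ofReal_one, ← Complex.ofReal_sub, Complex.norm_real, Real.norm_eq_abs, abs_le]
    constructor <;> linarith
  have e0 : scaledDist u v x - 1 = -((1 - u) * (exp (φ * I) - 1) / u) := by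
    rw [scaledDist, ← hφ]; field_simp; ring
  have e1 : scaledDist u v x - 1 + (1 - u) * (v * x) * I
      = -((1 - u) * (exp (φ * I) - 1 - φ * I) / u) := by
    rw [e0, hφ]; push_cast; field_simp; ring
  have hφa : |φ| = u * (v * |x|) := by
    rw [hφ, abs_mul, abs_mul, abs_of_pos hu0, abs_of_pos hv]; ring
  constructor
  · rw [e0, norm_neg, norm_div, norm_mul, Complex.norm_real, Real.norm_eq_abs, abs_of_pos hu0,
      div_le_iff₀ hu0]
    calc _ ≤ 1 * (2 * |φ|) := by gcongr
      _ = _ := by rw [hφa]; ring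
  · rw [e1, norm_neg, norm_div, norm_mul, Complex.norm_real, Real.norm_eq_abs, abs_of_pos hu0,
      div_le_iff₀ hu0]
    calc _ ≤ 1 * |φ| ^ 2 := by gcongr
      _ = _ := by rw [sq_abs, hφ]; ring

variable {a b : ℝ} {u v : ℕ → ℝ}

/-- At the saddle point `n u v ^ 2 = a b (1 - u)` the linear terms of the exponent cancel and
the quadratic one survives. -/
lemma tendsto_scaledIntegrand (c : ℝ) (hu : ∀ᶠ n in atTop, 0 < u n ∧ u n < 1)
    (hv : ∀ᶠ n in atTop, 0 < v n) (hu0 : Tendsto u atTop (𝓝 0)) (hv0 : Tendsto v atTop (𝓝 0))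
    (hsaddle : ∀ᶠ n : ℕ in atTop, n * u n * v n ^ 2 = a * b * (1 - u n)) (x : ℝ) :
    Tendsto (fun n => scaledIntegrand a b c n (u n) (v n) x) atTop
      (𝓝 (Real.exp (-(a * b * (b + 1) / 2) * x ^ 2) : ℝ)) := by
  set h : ℕ → ℂ := fun n => scaledDist (u n) (v n) x - 1 with hh
  have hsmall : ∀ᶠ n in atTop, |u n * v n * x| ≤ 1 := by
    have : Tendsto (fun n => |u n * v n * x|) atTop (𝓝 0) := by
      simpa using ((hu0.mul hv0).mul_const x).abs
    exact this.eventually_le_const one_pos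
  have hb1 : ∀ᶠ n in atTop, ‖h n‖ ≤ 2 * (v n * |x|) := by
    filter_upwards [hu, hv, hsmall] with n h1 h2 h3
    exact (scaledDist_sub_one_bounds h1.1 h1.2 h2 h3).1
  have hb2 : ∀ᶠ n in atTop, ‖h n + (1 - u n) * (v n * x) * I‖ ≤ u n * (v n * x) ^ 2 := by
    filter_upwards [hu, hv, hsmall] with n h1 h2 h3
    exact (scaledDist_sub_one_bounds h1.1 h1.2 h2 h3).2
  have hh0 : Tendsto h atTop (𝓝 0) := by
    refine squeeze_zero_norm' hb1 ?_
    simpa using (hv0.mul_const |x|).const_mul 2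
  have hu0c : Tendsto (fun n => (u n : ℂ)) atTop (𝓝 0) := by
    exact_mod_cast (Complex.continuous_ofReal.tendsto 0).comp hu0
  have hpre : Tendsto (fun n => scaledDist (u n) (v n) x ^ (-(c : ℂ))) atTop (𝓝 1) := by
    have h1 : Tendsto (fun n => scaledDist (u n) (v n) x) atTop (𝓝 1) := by
      simpa [hh] using hh0.add_const 1
    simpa [Function.comp_def] using
      (continuousAt_cpow_const (b := -(c : ℂ)) Complex.one_mem_slitPlane).tendsto.comp h1
  -- the remainder `O(h ^ 3)`, multiplied by `a / v ^ 2`, is `O(v)`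
  have hE1 : Tendsto (fun n => ((a / v n ^ 2 : ℝ) : ℂ) * ((1 + h n) ^ (-(b : ℂ))
      - (1 - b * h n + b * (b + 1) / 2 * h n ^ 2))) atTop (𝓝 0) := by
    obtain ⟨C, hC⟩ := ((one_add_cpow_sub_taylor_isBigO b).comp_tendsto hh0).bound
    have hlim : Tendsto (fun n => |a| * |C| * 8 * |x| ^ 3 * v n) atTop (𝓝 0) := by
      simpa using hv0.const_mul (|a| * |C| * 8 * |x| ^ 3)
    refine squeeze_zero_norm' ?_ hlim
    filter_upwards [hC, hb1, hv] with n h1 h2 h3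
    simp only [Function.comp_apply, norm_pow, norm_norm] at h1
    rw [norm_mul, Complex.norm_real, Real.norm_eq_abs, abs_div, abs_of_pos (pow_pos h3 2)]
    calc _ ≤ |a| / v n ^ 2 * (|C| * (2 * (v n * |x|)) ^ 3) := by
          gcongr
          refine h1.trans ?_
          gcongr
          exact le_abs_self C
      _ = _ := by field_simp; ring
  -- `h / v` tends to `-x I`
  have hE2 : Tendsto (fun n => ((a / v n ^ 2 : ℝ) : ℂ) * (b * (b + 1) / 2 * h n ^ 2)) atTop
      (𝓝 (-((a : ℂ) * b * (b + 1) / 2) * (x : ℂ) ^ 2)) := by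
    have hr : Tendsto (fun n => h n / v n + (1 - u n) * x * I) atTop (𝓝 0) := by
      have hlim : Tendsto (fun n => u n * v n * x ^ 2) atTop (𝓝 0) := by
        simpa using (hu0.mul hv0).mul_const (x ^ 2)
      refine squeeze_zero_norm' ?_ hlim
      filter_upwards [hb2, hv] with n h1 h2
      have hvn : (v n : ℂ) ≠ 0 := by exact_mod_cast h2.ne'
      have : h n / v n + (1 - u n) * x * I = (h n + (1 - u n) * (v n * x) * I) / v n := by
        field_simp
      rw [this, norm_div, Complex.norm_real, Real.norm_eq_abs, abs_of_pos h2, div_le_iff₀ h2]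
      exact h1.trans_eq (by ring)
    have hr2 : Tendsto (fun n => h n / v n) atTop (𝓝 (-(x * I))) := by
      have h1 : Tendsto (fun n => (1 - (u n : ℂ)) * x * I) atTop (𝓝 ((1 - 0) * x * I)) :=
        ((hu0c.const_sub 1).mul_const _).mul_const _
      simpa using hr.sub h1
    have h3 := (hr2.pow 2).const_mul ((a : ℂ) * (b * (b + 1) / 2))
    have hlim : (a : ℂ) * (b * (b + 1) / 2) * (-(x * I)) ^ 2
        = -(a * b * (b + 1) / 2) * x ^ 2 := by
      linear_combination (a : ℂ) * (b * (b + 1) / 2) * x ^ 2 * Complex.I_sq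
    rw [hlim] at h3
    refine h3.congr' ?_
    filter_upwards [hv] with n h2
    have hvn : (v n : ℂ) ≠ 0 := by exact_mod_cast h2.ne'
    push_cast
    field_simp
  -- at the saddle point the linear term cancels against the phase `n u v x`, up to `O(u)`
  have hE3 : Tendsto (fun n : ℕ => ((a / v n ^ 2 : ℝ) : ℂ) * (-(b * h n))
      - n * (u n * v n * x : ℝ) * I) atTop (𝓝 0) := by
    have hlim : Tendsto (fun n => |a * b| * x ^ 2 * u n) atTop (𝓝 0) := by
      simpa using hu0.const_mul (|a * b| * x ^ 2)
    refine squeeze_zero_norm' ?_ hlim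
    filter_upwards [hb2, hv, hsaddle] with n h1 h2 h3
    have hvn : (v n : ℂ) ≠ 0 := by exact_mod_cast h2.ne'
    have h3c : (n : ℂ) * u n * v n ^ 2 = a * b * (1 - u n) := by exact_mod_cast h3
    have : ((a / v n ^ 2 : ℝ) : ℂ) * (-(b * h n)) - n * (u n * v n * x : ℝ) * I
        = -(((a * b / v n ^ 2 : ℝ) : ℂ) * (h n + (1 - u n) * (v n * x) * I)) := by
      push_cast
      field_simp
      linear_combination (-(v n * x * I : ℂ)) * h3c
    rw [this, norm_neg, norm_mul, Complex.norm_real, Real.norm_eq_abs, abs_div,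
      abs_of_pos (pow_pos h2 2)]
    calc _ ≤ |a * b| / v n ^ 2 * (u n * (v n * x) ^ 2) := by gcongr
      _ = _ := by field_simp
  have hE := ((hE1.add hE2).add hE3).cexp
  have hlim := hpre.mul hE
  simp only [zero_add, add_zero, one_mul] at hlim
  have hgoal : ((Real.exp (-(a * b * (b + 1) / 2) * x ^ 2) : ℝ) : ℂ)
      = cexp (-((a : ℂ) * b * (b + 1) / 2) * (x : ℂ) ^ 2) := by push_cast; rfl
  rw [hgoal]
  refine hlim.congr fun n => ?_
  have h1 : scaledDist (u n) (v n) x = 1 + h n := by simp [hh]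
  rw [scaledIntegrand, h1]
  congr 2
  ring

/-- Laplace's method for Cauchy's integral over the circle through the saddle point. -/
lemma tendsto_integral_scaledIntegrand {c : ℝ} (ha : 0 < a) (hb : 0 < b) (hc : 0 < c)
    (hu : ∀ᶠ n in atTop, 0 < u n ∧ u n < 1) (hu0 : Tendsto u atTop (𝓝 0))
    (hv : ∀ᶠ n in atTop, v n = u n ^ (b / 2))
    (hsaddle : ∀ᶠ n : ℕ in atTop, n * u n * v n ^ 2 = a * b * (1 - u n)) :
    Tendsto (fun n => ∫ x in (-(π / (u n * v n)))..(π / (u n * v n)),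
      scaledIntegrand a b c n (u n) (v n) x) atTop (𝓝 (√(2 * π / (a * b * (b + 1))) : ℝ)) := by
  have hvpos : ∀ᶠ n in atTop, 0 < v n := by
    filter_upwards [hu, hv] with n h1 h2
    rw [h2]; exact Real.rpow_pos_of_pos h1.1 _
  have hv0 : Tendsto v atTop (𝓝 0) := by
    have h := hu0.rpow_const (p := b / 2) (Or.inr (by positivity))
    rw [Real.zero_rpow (by positivity)] at h
    exact h.congr' (hv.mono fun n h => h.symm)
  obtain ⟨δ, hδ0, hδ⟩ := exists_one_sub_rpow_ge hb (κ := 2 / π ^ 2) (by positivity)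
  set p : ℝ := 2 * b / (b + 2) with hp
  have hp0 : 0 < p := by positivity
  set m : ℝ := a * δ with hm
  have hm0 : 0 < m := by positivity
  set S : ℕ → Set ℝ := fun n => Set.Ioc (-(π / (u n * v n))) (π / (u n * v n)) with hS
  set F : ℕ → ℝ → ℂ := fun n => (S n).indicator (scaledIntegrand a b c n (u n) (v n)) with hF
  have hmain : Tendsto (fun n => ∫ x, F n x) atTop
      (𝓝 (∫ x : ℝ, ((Real.exp (-(a * b * (b + 1) / 2) * x ^ 2) : ℝ) : ℂ))) := by
    refine tendsto_integral_filter_of_dominated_convergence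
      (fun x => Real.exp (-m * x ^ 2) + Real.exp (-(m * (π ^ p)⁻¹) * |x| ^ p)) ?_ ?_ ?_ ?_
    · refine Eventually.of_forall fun n => Measurable.aestronglyMeasurable ?_
      refine Measurable.indicator ?_ measurableSet_Ioc
      unfold scaledIntegrand scaledDist
      fun_prop
    · filter_upwards [hu, hv, hvpos, hu0.eventually_le_const (half_pos one_pos)]
        with n h1 h2 h3 h4
      refine Eventually.of_forall fun x => ?_
      by_cases hx : x ∈ S n
      · have huv : 0 < u n * v n := mul_pos h1.1 h3
        have hxa : |x| ≤ π / (u n * v n) := abs_le.2 ⟨hx.1.le, hx.2⟩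
        have hx' : |u n * v n * x| ≤ π := by
          rw [abs_mul, abs_of_pos huv, mul_comm]; exact (le_div_iff₀ huv).1 hxa
        -- on the circle `|x| ≤ π / (u v)`, and `(u v) ^ p = v ^ 2` by the choice of `p`
        have hB : (π ^ p)⁻¹ * |x| ^ p ≤ (v n ^ 2)⁻¹ := by
          have h5 : |x| ^ p ≤ (π / (u n * v n)) ^ p :=
            Real.rpow_le_rpow (abs_nonneg x) hxa hp0.le
          have h6 : (u n * v n) ^ p = v n ^ 2 := by
            rw [h2, ← Real.rpow_one_add' h1.1.le (by positivity), ← Real.rpow_mul h1.1.le,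
              ← Real.rpow_natCast, ← Real.rpow_mul h1.1.le]
            congr 1
            rw [hp]; push_cast; field_simp; ring
          rw [Real.div_rpow Real.pi_pos.le huv.le, h6] at h5
          calc _ ≤ (π ^ p)⁻¹ * (π ^ p / v n ^ 2) := by gcongr
            _ = _ := by field_simp
        simp only [hF, Set.indicator_of_mem hx]
        refine (norm_scaledIntegrand_le ha hc n h1.1 h4 h3.ne' hx' hδ).trans ?_
        rcases le_total (x ^ 2) (v n ^ 2)⁻¹ with h7 | h7
        · rw [min_eq_left h7, ← neg_mul]
          exact le_add_of_nonneg_right (Real.exp_pos _).le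
        · rw [min_eq_right h7]
          refine le_add_of_nonneg_of_le (Real.exp_pos _).le (Real.exp_le_exp.2 ?_)
          have := mul_le_mul_of_nonneg_left hB hm0.le
          linarith
      · simp only [hF, Set.indicator_of_notMem hx, norm_zero]
        positivity
    · exact (integrable_exp_neg_mul_sq hm0).add
        (integrable_exp_neg_mul_abs_rpow (by positivity) hp0)
    · refine Eventually.of_forall fun x => ?_
      refine (tendsto_scaledIntegrand c hu hvpos hu0 hv0 hsaddle x).congr' ?_
      have hlarge : ∀ᶠ n in atTop, |u n * v n * x| < π := by
        have : Tendsto (fun n => |u n * v n * x|) atTop (𝓝 0) := by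
          simpa using ((hu0.mul hv0).mul_const x).abs
        exact this.eventually_lt_const Real.pi_pos
      filter_upwards [hu, hvpos, hlarge] with n h1 h3 h4
      have huv : 0 < u n * v n := mul_pos h1.1 h3
      have h5 : |x| < π / (u n * v n) := by
        rw [lt_div_iff₀ huv, mul_comm]; rwa [abs_mul, abs_of_pos huv] at h4
      have hx : x ∈ S n := ⟨(abs_lt.1 h5).1, (abs_lt.1 h5).2.le⟩
      simp only [hF, Set.indicator_of_mem hx]
  rw [integral_complex_ofReal, integral_gaussian] at hmain
  have hval : π / (a * b * (b + 1) / 2) = 2 * π / (a * b * (b + 1)) := by field_simp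
  rw [hval] at hmain
  refine hmain.congr' ?_
  filter_upwards [hu, hvpos] with n h1 h3
  have huv : 0 < π / (u n * v n) := div_pos Real.pi_pos (mul_pos h1.1 h3)
  rw [intervalIntegral.integral_of_le (by linarith), ← integral_indicator measurableSet_Ioc]

end SaddleLimit

/-! ### The coefficients in terms of the normalized integral -/

section SaddleFormula

open Complex Real MeasureTheory Topology

lemma ofReal_mul_cpow_of_pos {r : ℝ} (hr : 0 < r) {z : ℂ} (hz : z ≠ 0) (s : ℝ) :
    ((r : ℂ) * z) ^ (-(s : ℂ)) = ((r ^ (-s) : ℝ) : ℂ) * z ^ (-(s : ℂ)) := by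
  have hr' : (r : ℂ) ≠ 0 := by exact_mod_cast hr.ne'
  rw [Complex.ofReal_cpow hr.le, Complex.cpow_def_of_ne_zero (mul_ne_zero hr' hz),
    Complex.cpow_def_of_ne_zero hr', Complex.cpow_def_of_ne_zero hz,
    Complex.log_ofReal_mul hr hz, Complex.ofReal_log hr.le, ← Complex.exp_add]
  push_cast
  ring_nf

/-- Cauchy's formula on the circle `|z| = 1 - u`, with the value of the integrand at angle `0`
factored out and the angle rescaled by `u v`. -/
lemma subExpTheta_eq_mul_integral (A a c : ℝ) {b : ℝ} (n : ℕ) {u v : ℝ} (hu0 : 0 < u)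
    (hu1 : u < 1) (hv : v = u ^ (b / 2)) :
    subExpTheta A a b c (n + 1) =
      ((A * u ^ (-c) * Real.exp (a * u ^ (-b)) / (1 - u) ^ n * (u * v) / (2 * π) : ℝ) : ℂ) *
      ∫ x in (-(π / (u * v)))..(π / (u * v)), scaledIntegrand a b c n u v x := by
  have hv0 : 0 < v := hv ▸ Real.rpow_pos_of_pos hu0 _
  have huv : 0 < u * v := mul_pos hu0 hv0
  have hvb : u ^ (-b) = 1 / v ^ 2 := by
    rw [hv, ← Real.rpow_natCast, ← Real.rpow_mul hu0.le, one_div, ← Real.rpow_neg hu0.le]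
    congr 1; push_cast; ring
  have hu : (u : ℂ) ≠ 0 := by exact_mod_cast hu0.ne'
  have h1u : (1 - u : ℂ) ≠ 0 := by
    have : (1 - u : ℝ) ≠ 0 := by linarith
    exact_mod_cast this
  rw [subExpTheta, Nat.add_sub_cancel, taylorCoeffZero_eq_integral
    (differentiableOn_subExpGenFun A a b c) (sub_pos.2 hu1) (by linarith) n]
  set f : ℝ → ℂ := fun φ => subExpGenFun A a b c (((1 - u : ℝ) : ℂ) * exp (φ * I)) /
    (((1 - u : ℝ) : ℂ) * exp (φ * I)) ^ n with hf
  have hscale := intervalIntegral.integral_comp_mul_left (a := -(π / (u * v)))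
    (b := π / (u * v)) f huv.ne'
  have e1 : u * v * -(π / (u * v)) = -π := by field_simp
  have e2 : u * v * (π / (u * v)) = π := by field_simp
  rw [e1, e2, Complex.real_smul] at hscale
  have hpt : ∀ x : ℝ, f (u * v * x) =
      ((A * u ^ (-c) * Real.exp (a * u ^ (-b)) / (1 - u) ^ n : ℝ) : ℂ) *
        scaledIntegrand a b c n u v x := by
    intro x
    have hd : 1 - ((1 - u : ℝ) : ℂ) * exp ((u * v * x : ℝ) * I) = u * scaledDist u v x := by
      rw [scaledDist]; push_cast; field_simp
    have hq : scaledDist u v x ≠ 0 := by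
      intro h0
      rw [h0, mul_zero, sub_eq_zero] at hd
      have := congrArg norm hd
      rw [norm_mul, Complex.norm_exp_ofReal_mul_I, Complex.norm_real, norm_one, mul_one,
        Real.norm_eq_abs, abs_of_pos (sub_pos.2 hu1)] at this
      linarith
    simp only [hf, subExpGenFun, scaledIntegrand]
    rw [hd, ofReal_mul_cpow_of_pos hu0 hq, ofReal_mul_cpow_of_pos hu0 hq, mul_pow,
      ← Complex.exp_nat_mul, Complex.exp_sub, mul_sub, Complex.exp_sub, hvb]
    push_cast
    rw [← mul_assoc (n : ℂ)]
    have h1 := Complex.exp_ne_zero ((n : ℂ) * (u * v * x) * I)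
    have h2 := Complex.exp_ne_zero ((a : ℂ) / v ^ 2 * 1)
    field_simp
  simp only [hpt] at hscale
  rw [intervalIntegral.integral_const_mul] at hscale
  have huvc : ((u * v : ℝ) : ℂ) ≠ 0 := by exact_mod_cast huv.ne'
  have hfin : ∫ φ in (-π)..π, f φ = ((u * v : ℝ) : ℂ) *
      (((A * u ^ (-c) * Real.exp (a * u ^ (-b)) / (1 - u) ^ n : ℝ) : ℂ) *
        ∫ x in (-(π / (u * v)))..(π / (u * v)), scaledIntegrand a b c n u v x) := by
    rw [hscale, Complex.ofReal_inv, mul_inv_cancel_left₀ huvc]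
  rw [hfin]
  push_cast
  ring

end SaddleFormula

/-! ### The saddle point -/

section SaddlePoint

open Real Topology

lemma exists_saddlePoint {b K N : ℝ} (hb : 0 < b) (hK : 0 < K) (hN : 0 < N) :
    ∃ u : ℝ, 0 < u ∧ u < 1 ∧ N * u ^ (b + 1) = K * (1 - u) := by
  have hcont : ContinuousOn (fun u : ℝ => N * u ^ (b + 1) - K * (1 - u)) (Set.Icc 0 1) := by
    refine ((Continuous.continuousOn ?_).sub (by fun_prop))
    exact continuous_const.mul (Real.continuous_rpow_const (by linarith))
  have h := intermediate_value_Ioo zero_le_one hcont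
  have h0 : (0 : ℝ) ∈ Set.Ioo (N * (0 : ℝ) ^ (b + 1) - K * (1 - 0))
      (N * (1 : ℝ) ^ (b + 1) - K * (1 - 1)) := by
    rw [Real.zero_rpow (by linarith), Real.one_rpow]
    constructor <;> linarith
  obtain ⟨u, hu, hu'⟩ := h h0
  exact ⟨u, hu.1, hu.2, sub_eq_zero.1 hu'⟩

/-- The tangent line inequality for the convex function `u ↦ u ^ (-b)`, at the point `u`. -/
lemma rpow_neg_tangent_le {b u w : ℝ} (hb : 0 < b) (hu : 0 < u) (hw : 0 < w) :
    u ^ (-b) * (1 - b * (w / u - 1)) ≤ w ^ (-b) := by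
  have h1 : w ^ (-b) = u ^ (-b) * (w / u) ^ (-b) := by
    rw [← Real.mul_rpow hu.le (by positivity), mul_div_cancel₀ _ hu.ne']
  rw [h1]
  gcongr
  have hwu : 0 < w / u := by positivity
  rw [Real.rpow_def_of_pos hwu]
  have h2 := Real.add_one_le_exp (Real.log (w / u) * -b)
  have h3 := Real.log_le_sub_one_of_pos hwu
  nlinarith

lemma neg_log_one_sub_bounds {u : ℝ} (hu0 : 0 ≤ u) (hu1 : u ≤ 1 / 2) :
    u + u ^ 2 / 2 - 2 * u ^ 3 ≤ -Real.log (1 - u) ∧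
      -Real.log (1 - u) ≤ u + u ^ 2 / 2 + 2 * u ^ 3 := by
  have h := Real.abs_log_sub_add_sum_range_le (x := u) (by rw [abs_of_nonneg hu0]; linarith) 2
  rw [abs_of_nonneg hu0] at h
  have h2 : u ^ (2 + 1) / (1 - u) ≤ 2 * u ^ 3 := by
    rw [div_le_iff₀ (by linarith), show 2 + 1 = 3 from rfl]
    nlinarith [mul_nonneg (pow_nonneg hu0 3) (by linarith : 0 ≤ 1 - 2 * u)]
  have h3 := abs_le.1 (h.trans h2)
  norm_num [Finset.sum_range_succ] at h3
  constructor <;> linarith [h3.1, h3.2]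

variable {a b N u u₀ : ℝ}

/-- Comparison of the saddle point `u` with its first approximation `u₀`. -/
lemma saddlePoint_bounds (hb : 0 < b) (hN : 0 < N) (hu0 : 0 < u) (hu1 : u < 1)
    (hu : N * u ^ (b + 1) = a * b * (1 - u)) (h0 : 0 < u₀) (h : N * u₀ ^ (b + 1) = a * b) :
    u ≤ u₀ ∧ u₀ * (1 - u₀) ≤ u := by
  have hrel : u ^ (b + 1) = u₀ ^ (b + 1) * (1 - u) := by
    apply mul_left_cancel₀ hN.ne'
    rw [hu, ← h]; ring
  have hp : 0 < u₀ ^ (b + 1) := Real.rpow_pos_of_pos h0 _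
  have hle : u ≤ u₀ := by
    refine (Real.rpow_le_rpow_iff hu0.le h0.le (by linarith : 0 < b + 1)).1 ?_
    rw [hrel]; nlinarith
  refine ⟨hle, ?_⟩
  have h1 : u₀ * (1 - u) ≤ u := by
    refine (Real.rpow_le_rpow_iff (by nlinarith) hu0.le (by linarith : 0 < b + 1)).1 ?_
    rw [hrel, Real.mul_rpow h0.le (by linarith)]
    gcongr
    calc (1 - u) ^ (b + 1) ≤ (1 - u) ^ (1 : ℝ) :=
          Real.rpow_le_rpow_of_exponent_ge (by linarith) (by linarith) (by linarith)
      _ = 1 - u := Real.rpow_one _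
  nlinarith

/-- The value of `a u ^ (-b) - N log (1 - u)` at its minimizer `u`, up to `O(N u₀ ^ 3)`.  The
upper bound compares with the value at `u₀`; the lower bound uses that `u₀` minimizes
`a u ^ (-b) + N u`. -/
lemma abs_saddleValue_sub_le (ha : 0 < a) (hb : 0 < b) (hN : 0 < N) (hu0 : 0 < u) (hu1 : u < 1)
    (hu : N * u ^ (b + 1) = a * b * (1 - u)) (h0 : 0 < u₀) (h1 : u₀ ≤ 1 / 2)
    (h : N * u₀ ^ (b + 1) = a * b) :
    |a * u ^ (-b) - N * Real.log (1 - u) - (a * u₀ ^ (-b) + N * u₀ + N * u₀ ^ 2 / 2)|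
      ≤ 3 * (N * u₀ ^ 3) := by
  obtain ⟨hle, hge⟩ := saddlePoint_bounds hb hN hu0 hu1 hu h0 h
  have hpow : ∀ {w : ℝ}, 0 < w → w ^ (b + 1) * w ^ (-b) = w := fun hw => by
    rw [← Real.rpow_add hw]; simp
  have hNu : N * u = a * b * (1 - u) * u ^ (-b) := by
    rw [← hu, mul_assoc, hpow hu0]
  have hNu0 : N * u₀ = a * b * u₀ ^ (-b) := by rw [← h, mul_assoc, hpow h0]
  obtain ⟨l1, -⟩ := neg_log_one_sub_bounds hu0.le (hle.trans h1)
  obtain ⟨-, l2⟩ := neg_log_one_sub_bounds h0.le h1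
  have hlow : a * u₀ ^ (-b) + N * u₀ ≤ a * u ^ (-b) + N * u := by
    have ht := mul_le_mul_of_nonneg_left (rpow_neg_tangent_le hb h0 hu0) ha.le
    have e : a * (u₀ ^ (-b) * (1 - b * (u / u₀ - 1))) = a * u₀ ^ (-b) + N * u₀ - N * u := by
      have : N * u = N * u₀ * (u / u₀) := by field_simp
      rw [this, hNu0]; ring
    linarith
  have hupp : a * u ^ (-b) - N * Real.log (1 - u) ≤ a * u₀ ^ (-b) - N * Real.log (1 - u₀) := by
    have ht := mul_le_mul_of_nonneg_left (rpow_neg_tangent_le hb hu0 h0) ha.le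
    have e : a * (u ^ (-b) * (1 - b * (u₀ / u - 1)))
        = a * u ^ (-b) - N * ((u₀ - u) / (1 - u)) := by
      have h2 : 1 - u ≠ 0 := by linarith
      have h3 : a * b * u ^ (-b) = N * u / (1 - u) := by rw [hNu]; field_simp
      have h4 : a * (u ^ (-b) * (1 - b * (u₀ / u - 1)))
        = a * u ^ (-b) - a * b * u ^ (-b) * (u₀ / u - 1) := by ring
      rw [h4, h3]; field_simp
    have hl := Real.log_le_sub_one_of_pos
      (div_pos (by linarith : 0 < 1 - u₀) (by linarith : 0 < 1 - u))
    rw [Real.log_div (by linarith) (by linarith)] at hl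
    have e2 : (1 - u₀) / (1 - u) - 1 = -((u₀ - u) / (1 - u)) := by
      have h2 : 1 - u ≠ 0 := by linarith
      field_simp; ring
    rw [e2] at hl
    have := mul_le_mul_of_nonneg_left hl hN.le
    linarith
  have hcube : u ^ 3 ≤ u₀ ^ 3 := by gcongr
  have hsq : u₀ ^ 2 - 2 * u₀ ^ 3 ≤ u ^ 2 := by
    have : (u₀ * (1 - u₀)) ^ 2 ≤ u ^ 2 := by
      have : 0 ≤ u₀ * (1 - u₀) := mul_nonneg h0.le (by linarith)
      gcongr
    nlinarith [sq_nonneg (u₀ ^ 2)]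
  have L1 := mul_le_mul_of_nonneg_left l1 hN.le
  have L2 := mul_le_mul_of_nonneg_left l2 hN.le
  have L3 := mul_le_mul_of_nonneg_left hcube hN.le
  have L4 := mul_le_mul_of_nonneg_left hsq hN.le
  rw [abs_le]
  constructor <;> linarith

end SaddlePoint

/-! ### Asymptotics of the coefficients -/

lemma isLittleO_rpow_rpow_atTop {p q : ℝ} (h : p < q) :
    (fun x : ℝ => x ^ p) =o[atTop] fun x : ℝ => x ^ q := by
  refine isLittleO_of_tendsto' ?_ ?_
  · filter_upwards [eventually_gt_atTop 0] with x hx h0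
    exact absurd h0 (Real.rpow_pos_of_pos hx q).ne'
  · refine (tendsto_rpow_neg_atTop (sub_pos.2 h)).congr' ?_
    filter_upwards [eventually_gt_atTop 0] with x hx
    rw [neg_sub, Real.rpow_sub hx]

open Topology in
theorem mainTheorem10 (A a b c : ℝ) (hA : 0 < A) (ha : 0 < a) (hb : 0 < b) (hc : 0 < c) :
    ∃ ε : ℕ → ℝ,
      (ε =o[atTop] fun n : ℕ => (n : ℝ) ^ (max ((b - 1) / (b + 1)) 0)) ∧
      ∀ n : ℕ, 1 ≤ n →
        subExpTheta A a b c (n + 1) =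
          ((A * (a * b) ^ (1 / (b + 1) * (1 / 2 - c)) / Real.sqrt (2 * Real.pi * (b + 1))
              * (n : ℝ) ^ (1 / (b + 1) * (c - (b + 2) / 2))
              * Real.exp
                  ((a * (b + 1) * (a * b) ^ (-(b / (b + 1)))) * (n : ℝ) ^ (b / (b + 1))
                    + (1 / 2 * (a * b) ^ (2 / (b + 1))) * (n : ℝ) ^ ((b - 1) / (b + 1))
                    + ε n) : ℝ) : ℂ) := by
  have hK : 0 < a * b := mul_pos ha hb
  choose T hT0 hT using exists_subExpTheta_eq_ofReal hA ha hb hc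
  set B : ℕ → ℝ := fun n => A * (a * b) ^ (1 / (b + 1) * (1 / 2 - c)) /
    Real.sqrt (2 * Real.pi * (b + 1)) * (n : ℝ) ^ (1 / (b + 1) * (c - (b + 2) / 2)) with hB
  set E : ℕ → ℝ := fun n =>
    (a * (b + 1) * (a * b) ^ (-(b / (b + 1)))) * (n : ℝ) ^ (b / (b + 1))
      + (1 / 2 * (a * b) ^ (2 / (b + 1))) * (n : ℝ) ^ ((b - 1) / (b + 1)) with hE
  have hB0 : ∀ n : ℕ, 1 ≤ n → 0 < B n := fun n hn => by
    have : (0 : ℝ) < n := by exact_mod_cast hn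
    have := Real.pi_pos
    positivity
  -- positivity of the coefficients lets `ε` be defined by a logarithm for every `n ≥ 1`
  refine ⟨fun n => Real.log (T n) - Real.log (B n) - E n, ?_, fun n hn => ?_⟩
  swap
  · rw [hT]
    congr 1
    change T n = B n * Real.exp (E n + (Real.log (T n) - Real.log (B n) - E n))
    rw [add_sub_cancel, Real.exp_sub, Real.exp_log (hT0 n), Real.exp_log (hB0 n hn),
      mul_div_cancel₀ _ (hB0 n hn).ne']
  -- the saddle points and their first approximations
  have hex : ∀ n : ℕ, ∃ u : ℝ, 1 ≤ n → 0 < u ∧ u < 1 ∧ n * u ^ (b + 1) = a * b * (1 - u) := by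
    intro n
    by_cases hn : 1 ≤ n
    · obtain ⟨u, hu⟩ := exists_saddlePoint hb hK (by exact_mod_cast hn : (0 : ℝ) < n)
      exact ⟨u, fun _ => hu⟩
    · exact ⟨0, fun h => absurd h hn⟩
  choose u hu using hex
  set w : ℕ → ℝ := fun n => (a * b / n) ^ (1 / (b + 1)) with hw
  have hwpos : ∀ n : ℕ, 1 ≤ n → 0 < w n := fun n hn => by
    have : (0 : ℝ) < n := by exact_mod_cast hn
    positivity
  have hwlim : Tendsto w atTop (𝓝 0) := by
    have h := (tendsto_const_div_atTop_nhds_zero_nat (a * b)).rpow_const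
      (p := 1 / (b + 1)) (Or.inr (by positivity))
    rwa [Real.zero_rpow (by positivity)] at h
  have hwrpow : ∀ n : ℕ, 1 ≤ n → ∀ s : ℝ,
      w n ^ s = (a * b) ^ (s / (b + 1)) * (n : ℝ) ^ (-(s / (b + 1))) := by
    intro n hn s
    have hn' : (0 : ℝ) < n := by exact_mod_cast hn
    rw [hw, ← Real.rpow_mul (by positivity), Real.div_rpow hK.le hn'.le, div_eq_mul_inv,
      ← Real.rpow_neg hn'.le]
    ring_nf
  have hwsaddle : ∀ n : ℕ, 1 ≤ n → n * w n ^ (b + 1) = a * b := by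
    intro n hn
    have hn' : (0 : ℝ) < n := by exact_mod_cast hn
    rw [hwrpow n hn, div_self (by positivity), Real.rpow_one, Real.rpow_neg_one]
    field_simp
  have huw : ∀ n : ℕ, 1 ≤ n → u n ≤ w n ∧ w n * (1 - w n) ≤ u n := fun n hn =>
    saddlePoint_bounds hb (by exact_mod_cast hn) (hu n hn).1 (hu n hn).2.1 (hu n hn).2.2
      (hwpos n hn) (hwsaddle n hn)
  have hulim : Tendsto u atTop (𝓝 0) := by
    refine squeeze_zero' ?_ ?_ hwlim
    · filter_upwards [eventually_ge_atTop 1] with n hn using (hu n hn).1.le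
    · filter_upwards [eventually_ge_atTop 1] with n hn using (huw n hn).1
  have hlogratio : Tendsto (fun n => Real.log (u n / w n)) atTop (𝓝 0) := by
    have h1 : Tendsto (fun n => u n / w n) atTop (𝓝 1) := by
      have h0 : Tendsto (fun n => 1 - w n) atTop (𝓝 1) := by simpa using hwlim.const_sub 1
      refine tendsto_of_tendsto_of_tendsto_of_le_of_le' h0 tendsto_const_nhds ?_ ?_
      · filter_upwards [eventually_ge_atTop 1] with n hn
        rw [le_div_iff₀ (hwpos n hn), mul_comm]; exact (huw n hn).2
      · filter_upwards [eventually_ge_atTop 1] with n hn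
        rw [div_le_one (hwpos n hn)]; exact (huw n hn).1
    simpa using h1.log one_ne_zero
  -- `T n / P n` is the normalized integral of Cauchy's formula
  set v : ℕ → ℝ := fun n => u n ^ (b / 2) with hv
  set P : ℕ → ℝ := fun n => A * u n ^ (-c) * Real.exp (a * u n ^ (-b)) / (1 - u n) ^ n *
    (u n * v n) / (2 * Real.pi) with hP
  have hP0 : ∀ n, 1 ≤ n → 0 < P n := fun n hn => by
    have h1 := (hu n hn).1
    have h2 := sub_pos.2 (hu n hn).2.1
    have := Real.pi_pos
    positivity
  have hJ : Tendsto (fun n => T n / P n) atTop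
      (𝓝 (√(2 * Real.pi / (a * b * (b + 1))))) := by
    have h := tendsto_integral_scaledIntegrand (u := u) (v := v) ha hb hc
      (by filter_upwards [eventually_ge_atTop 1] with n hn using ⟨(hu n hn).1, (hu n hn).2.1⟩)
      hulim (Eventually.of_forall fun n => rfl) (by
        filter_upwards [eventually_ge_atTop 1] with n hn
        rw [← (hu n hn).2.2, hv, ← Real.rpow_natCast, ← Real.rpow_mul (hu n hn).1.le,
          Real.rpow_add (hu n hn).1, Real.rpow_one]
        have : b / 2 * ((2 : ℕ) : ℝ) = b := by push_cast; ring
        rw [this]; ring)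
    refine ((Complex.continuous_re.tendsto _).comp h).congr' ?_
    filter_upwards [eventually_ge_atTop 1] with n hn
    have h1 := subExpTheta_eq_mul_integral A a c n (hu n hn).1 (hu n hn).2.1 (rfl : v n = _)
    rw [hT] at h1
    have hPc : ((P n : ℝ) : ℂ) ≠ 0 := by exact_mod_cast (hP0 n hn).ne'
    rw [Function.comp_apply, eq_div_of_mul_eq hPc ((mul_comm _ _).trans h1.symm),
      ← Complex.ofReal_div, Complex.ofReal_re]
  have hGpos : 0 < 2 * Real.pi / (a * b * (b + 1)) := by
    have := Real.pi_pos
    positivity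
  have hlogJ : Tendsto (fun n => Real.log (T n / P n)
      - Real.log (√(2 * Real.pi / (a * b * (b + 1))))) atTop (𝓝 0) := by
    simpa using (hJ.log (Real.sqrt_pos.2 hGpos).ne').sub_const
      (Real.log (√(2 * Real.pi / (a * b * (b + 1)))))
  -- `D n` is the error in the value of the exponent at the saddle point
  set D : ℕ → ℝ := fun n => a * u n ^ (-b) - n * Real.log (1 - u n)
    - (a * w n ^ (-b) + n * w n + n * w n ^ 2 / 2) with hD
  have hEw : ∀ n : ℕ, 1 ≤ n → a * w n ^ (-b) + n * w n + n * w n ^ 2 / 2 = E n := by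
    intro n hn
    have hn' : (0 : ℝ) < n := by exact_mod_cast hn
    have h1 : n * w n = a * b * w n ^ (-b) := by
      rw [← hwsaddle n hn, mul_assoc, ← Real.rpow_add (hwpos n hn)]; simp
    have h2 : n * w n ^ 2 = (a * b) ^ (2 / (b + 1)) * (n : ℝ) ^ ((b - 1) / (b + 1)) := by
      rw [← Real.rpow_two, hwrpow n hn]
      have : (b - 1) / (b + 1) = 1 + -(2 / (b + 1)) := by field_simp; ring
      rw [this, Real.rpow_add hn', Real.rpow_one]
      ring
    rw [h1, h2, hwrpow n hn, hE, neg_div, neg_neg]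
    ring
  have hid : (fun n => Real.log (T n) - Real.log (B n) - E n) =ᶠ[atTop] fun n =>
      ((Real.log (T n / P n) - Real.log (√(2 * Real.pi / (a * b * (b + 1)))))
        + (1 + b / 2 - c) * Real.log (u n / w n)) + D n := by
    filter_upwards [eventually_ge_atTop 1] with n hn
    have hn' : (0 : ℝ) < n := by exact_mod_cast hn
    obtain ⟨h1, h2, -⟩ := hu n hn
    have h3 := sub_pos.2 h2
    have hpi := Real.pi_pos
    have hvn : 0 < v n := Real.rpow_pos_of_pos h1 _
    have hb1 : 0 < b + 1 := by linarith
    have hlw : Real.log (w n) = 1 / (b + 1) * (Real.log (a * b) - Real.log n) := by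
      rw [hw, Real.log_rpow (by positivity), Real.log_div hK.ne' hn'.ne']
    have hlP : Real.log (P n) = Real.log A - c * Real.log (u n) + a * u n ^ (-b)
        - n * Real.log (1 - u n) + (Real.log (u n) + b / 2 * Real.log (u n))
        - Real.log (2 * Real.pi) := by
      rw [hP, Real.log_div (by positivity) (by positivity), Real.log_mul (by positivity)
        (by positivity), Real.log_div (by positivity) (by positivity), Real.log_mul (by positivity)
        (by positivity), Real.log_mul hA.ne' (by positivity), Real.log_exp, Real.log_rpow h1,
        Real.log_pow, Real.log_mul h1.ne' hvn.ne', Real.log_rpow h1]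
      ring
    have hlB : Real.log (B n) = Real.log A + 1 / (b + 1) * (1 / 2 - c) * Real.log (a * b)
        - (Real.log (2 * Real.pi) + Real.log (b + 1)) / 2
        + 1 / (b + 1) * (c - (b + 2) / 2) * Real.log n := by
      rw [hB, Real.log_mul (by positivity) (by positivity), Real.log_div (by positivity)
        (by positivity), Real.log_mul hA.ne' (by positivity), Real.log_rpow hK,
        Real.log_rpow hn', Real.log_sqrt (by positivity), Real.log_mul (by positivity) hb1.ne']
    have hlG : Real.log (2 * Real.pi / (a * b * (b + 1)))
        = Real.log (2 * Real.pi) - (Real.log (a * b) + Real.log (b + 1)) := by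
      rw [Real.log_div (by positivity) (by positivity), Real.log_mul hK.ne' hb1.ne']
    rw [Real.log_div (hT0 n).ne' (hP0 n hn).ne', Real.log_sqrt hGpos.le, hlG,
      Real.log_div h1.ne' (hwpos n hn).ne', hlP, hlB, hlw, hD]
    simp only [hEw n hn]
    field_simp
    ring
  have hDo : D =o[atTop] fun n : ℕ => (n : ℝ) ^ (max ((b - 1) / (b + 1)) 0) := by
    have hbig : D =O[atTop] fun n : ℕ => (n : ℝ) ^ ((b - 2) / (b + 1)) := by
      refine IsBigO.of_bound (3 * (a * b) ^ (3 / (b + 1))) ?_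
      filter_upwards [eventually_ge_atTop 1, hwlim.eventually_le_const (half_pos one_pos)]
        with n hn hw2
      have hn' : (0 : ℝ) < n := by exact_mod_cast hn
      rw [Real.norm_eq_abs, Real.norm_eq_abs, abs_of_pos (Real.rpow_pos_of_pos hn' _)]
      refine (abs_saddleValue_sub_le ha hb hn' (hu n hn).1 (hu n hn).2.1 (hu n hn).2.2
        (hwpos n hn) hw2 (hwsaddle n hn)).trans_eq ?_
      have h3 : w n ^ 3 = w n ^ (3 : ℝ) := by norm_cast
      have : (b - 2) / (b + 1) = 1 + -(3 / (b + 1)) := by field_simp; ring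
      rw [h3, hwrpow n hn, this, Real.rpow_add hn', Real.rpow_one]
      ring
    refine hbig.trans_isLittleO ?_
    have hlt : (b - 2) / (b + 1) < max ((b - 1) / (b + 1)) 0 :=
      lt_max_of_lt_left (by gcongr; linarith)
    exact (isLittleO_rpow_rpow_atTop hlt).comp_tendsto tendsto_natCast_atTop_atTop
  have hone : (fun _ : ℕ => (1 : ℝ)) =O[atTop]
      fun n : ℕ => (n : ℝ) ^ (max ((b - 1) / (b + 1)) 0) := by
    refine IsBigO.of_bound 1 ?_
    filter_upwards [eventually_ge_atTop 1] with n hn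
    have hn' : (1 : ℝ) ≤ n := by exact_mod_cast hn
    rw [norm_one, one_mul]
    exact (Real.one_le_rpow hn' (le_max_right _ _)).trans (le_abs_self _)
  refine IsLittleO.congr' (IsLittleO.add ?_ hDo) hid.symm EventuallyEq.rfl
  refine IsLittleO.trans_isBigO ((isLittleO_one_iff ℝ).2 ?_) hone
  simpa using hlogJ.add (hlogratio.const_mul (1 + b / 2 - c))
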